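/- Let $E$ be a real or complex Banach space, let $J=\{1,2,3,\dots\}$ or $J=(0,\infty)$, and let $(T_t)_{t\in J}$ be a semigroup of bounded linear operators on $E$, i.e. $T_{s+t}=T_sT_t$ for all $s,t\in J$ (no continuity in $t$ is required). Assume that it is locally bounded at $0$, i.e. $\sup_{t\in(0,c]\cap J}\|T_t\|<\infty$ for some $c\in J$. Let $\mathscr U$ be a free ultrafilter on $\mathbb N$, and let $P$ be a bounded linear operator on $E$. Let $$E^{\mathscr U}=\ell^\infty(\mathbb N;E)\big/\{(f_n)\in\ell^\infty(\mathbb N;E):\lim_{\mathscr U}f_n=0\}$$ be the ultrapower of $E$, with the quotient norm, and for a bounded linear operator $S$ on $E$ let $S^{\mathscr U}$ be the bounded operator on $E^{\mathscr U}$ which maps the class of $(f_n)$ to the class of $(Sf_n)$. Then the following assertions are equivalent: (i) $T_t\to P$ in operator norm as $t\to\infty$. (ii) $T_t^{\mathscr U}\to P^{\mathscr U}$ in operator norm on $E^{\mathscr U}$ as $t\to\infty$. (iii) $T_t^{\mathscr U}x\to P^{\mathscr U}x$ in $E^{\mathscr U}$ as $t\to\infty$ for every $x\in E^{\mathscr U}$.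 -/

import Mathlib

open Filter Topology
open scoped ENNReal

noncomputable section

namespace UltraPower

variable (𝕜 : Type*) [RCLike 𝕜] (E : Type*) [NormedAddCommGroup E] [NormedSpace 𝕜 E]

/-- The space `ℓ^∞(ℕ; E)` of bounded sequences in `E`, with the supremum norm. -/
abbrev EllInfty (E : Type*) [NormedAddCommGroup E] : Type _ :=
  lp (fun _ : ℕ => E) ∞

/-- The subspace `c_{0,U}(ℕ; E)` of all bounded sequences in `E` with limit `0` along `U`. -/
def cZero (U : Ultrafilter ℕ) : Submodule 𝕜 (EllInfty E) where
  carrier := {f | Tendsto (fun n => f n) (U : Filter ℕ) (𝓝 0)}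
  zero_mem' := by
    exact (tendsto_const_nhds : Tendsto (fun _ : ℕ => (0 : E)) (U : Filter ℕ) (𝓝 0))
  add_mem' := by
    intro f g hf hg
    simpa using Tendsto.add hf hg
  smul_mem' := by
    intro c f hf
    simpa using Tendsto.const_smul hf c

theorem mem_cZero {U : Ultrafilter ℕ} {f : EllInfty E} :
    f ∈ cZero 𝕜 E U ↔ Tendsto (fun n => f n) (U : Filter ℕ) (𝓝 0) := Iff.rfl

/-- The subspace `c_{0,U}(ℕ; E)` is closed, so that the quotient by it is a normed space. -/
instance isClosed_cZero (U : Ultrafilter ℕ) :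
    IsClosed ((cZero 𝕜 E U : Submodule 𝕜 (EllInfty E)) : Set (EllInfty E)) := by
  rw [← isSeqClosed_iff_isClosed]
  intro u f hu hf
  change Tendsto (fun n => f n) (U : Filter ℕ) (𝓝 0)
  rw [Metric.tendsto_nhds]
  intro ε hε
  obtain ⟨k, hk⟩ := ((Metric.tendsto_nhds.1 hf) (ε / 2) (half_pos hε)).exists
  have huk : Tendsto (fun n => u k n) (U : Filter ℕ) (𝓝 0) := hu k
  filter_upwards [(Metric.tendsto_nhds.1 huk) (ε / 2) (half_pos hε)] with n hn
  have h1 : ‖u k n - f n‖ ≤ ‖u k - f‖ := lp.norm_apply_le_norm (by simp) (u k - f) n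
  rw [dist_eq_norm] at hk
  rw [dist_zero_right] at hn ⊢
  have h2 : ‖f n‖ ≤ ‖u k n‖ + ‖u k n - f n‖ := by
    have := norm_sub_le (u k n) (u k n - f n)
    simpa using this
  linarith

/-- The ultra power `E^U = ℓ^∞(ℕ; E) / c_{0,U}(ℕ; E)`, with the quotient norm. -/
def Space (U : Ultrafilter ℕ) : Type _ := EllInfty E ⧸ cZero 𝕜 E U

instance (U : Ultrafilter ℕ) : NormedAddCommGroup (Space 𝕜 E U) :=
  inferInstanceAs (NormedAddCommGroup (EllInfty E ⧸ cZero 𝕜 E U))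

instance (U : Ultrafilter ℕ) : NormedSpace 𝕜 (Space 𝕜 E U) :=
  inferInstanceAs (NormedSpace 𝕜 (EllInfty E ⧸ cZero 𝕜 E U))

instance (U : Ultrafilter ℕ) [CompleteSpace E] : CompleteSpace (Space 𝕜 E U) :=
  inferInstanceAs (CompleteSpace (EllInfty E ⧸ cZero 𝕜 E U))

variable {𝕜 E}

variable (𝕜) in
/-- The class `f^U ∈ E^U` of a bounded sequence `f`. -/
def mk (U : Ultrafilter ℕ) (f : EllInfty E) : Space 𝕜 E U :=
  Submodule.Quotient.mk (p := cZero 𝕜 E U) f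

theorem mk_surjective (U : Ultrafilter ℕ) :
    Function.Surjective (mk 𝕜 U : EllInfty E → Space 𝕜 E U) :=
  Submodule.Quotient.mk_surjective (cZero 𝕜 E U)

theorem norm_mk_le (U : Ultrafilter ℕ) (f : EllInfty E) : ‖mk 𝕜 U f‖ ≤ ‖f‖ :=
  Submodule.Quotient.norm_mk_le (cZero 𝕜 E U) f

/-- The operator `(f_n) ↦ (T f_n)` on `ℓ^∞(ℕ; E)`. -/
def seqMap (T : E →L[𝕜] E) : EllInfty E →L[𝕜] EllInfty E :=
  LinearMap.mkContinuous
    { toFun := fun f => ⟨fun n => T (f n), memℓp_infty ⟨‖T‖ * ‖f‖, by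
        rintro _ ⟨n, rfl⟩
        exact T.le_opNorm_of_le (lp.norm_apply_le_norm (by simp) f n)⟩⟩
      map_add' := by
        intro f g
        ext n
        exact map_add T (f n) (g n)
      map_smul' := by
        intro c f
        ext n
        exact map_smul T c (f n) }
    ‖T‖ (by
      intro f
      refine lp.norm_le_of_forall_le (by positivity) fun n => ?_
      exact T.le_opNorm_of_le (lp.norm_apply_le_norm (by simp) f n))

theorem seqMap_apply (T : E →L[𝕜] E) (f : EllInfty E) (n : ℕ) : seqMap T f n = T (f n) := rfl

theorem seqMap_mem_cZero (U : Ultrafilter ℕ) (T : E →L[𝕜] E) (f : EllInfty E)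
    (hf : f ∈ cZero 𝕜 E U) : seqMap T f ∈ cZero 𝕜 E U := by
  rw [mem_cZero]
  have := (T.continuous.tendsto 0).comp ((mem_cZero 𝕜 E).1 hf)
  rwa [map_zero] at this

/-- The lifting `T^U` as a linear map. -/
def liftLin (U : Ultrafilter ℕ) (T : E →L[𝕜] E) : Space 𝕜 E U →ₗ[𝕜] Space 𝕜 E U :=
  Submodule.mapQ (cZero 𝕜 E U) (cZero 𝕜 E U) (seqMap T : EllInfty E →ₗ[𝕜] EllInfty E)
    (seqMap_mem_cZero U T)

theorem norm_liftLin_le (U : Ultrafilter ℕ) (T : E →L[𝕜] E) (x : Space 𝕜 E U) :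
    ‖liftLin U T x‖ ≤ ‖T‖ * ‖x‖ := by
  have key : ∀ f : EllInfty E, mk 𝕜 U f = x → ‖liftLin U T x‖ ≤ ‖T‖ * ‖f‖ := by
    rintro f rfl
    have h1 : ‖liftLin U T (mk 𝕜 U f)‖ ≤ ‖seqMap T f‖ := norm_mk_le U (seqMap T f)
    exact h1.trans (LinearMap.mkContinuous_norm_le _ (norm_nonneg T) _ |> (seqMap T).le_of_opNorm_le <| f)
  refine le_of_forall_pos_le_add fun ε hε => ?_
  have hδ : 0 < ε / (‖T‖ + 1) := by positivity
  obtain ⟨f, hf, hfx⟩ := Submodule.Quotient.norm_mk_lt (S := cZero 𝕜 E U) x hδ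
  have h2 : ‖T‖ * ‖f‖ ≤ ‖T‖ * (‖x‖ + ε / (‖T‖ + 1)) :=
    mul_le_mul_of_nonneg_left hfx.le (norm_nonneg T)
  have h3 : ‖T‖ * (ε / (‖T‖ + 1)) ≤ ε := by
    rw [mul_div_assoc', div_le_iff₀ (by positivity)]
    nlinarith [norm_nonneg T]
  linarith [key f hf]

/-- The lifting `T^U` of a bounded operator `T` on `E` to the ultra power `E^U`: it sends the class
of `(f_n)` to the class of `(T f_n)`. -/
def lift (U : Ultrafilter ℕ) (T : E →L[𝕜] E) : Space 𝕜 E U →L[𝕜] Space 𝕜 E U :=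
  LinearMap.mkContinuous (liftLin U T) ‖T‖ (norm_liftLin_le U T)

theorem lift_mk (U : Ultrafilter ℕ) (T : E →L[𝕜] E) (f : EllInfty E) :
    lift U T (mk 𝕜 U f) = mk 𝕜 U (seqMap T f) := rfl

/-- The semigroup law `T_{s+t} = T_s T_t` for all `s, t ∈ J`, for a family of bounded operators
indexed by a set `J` of times. -/
def IsSemigroup {J : Set ℝ} (T : J → E →L[𝕜] E) : Prop :=
  ∀ r s t : J, (r : ℝ) = s + t → T r = (T s).comp (T t)

/-- Local boundedness at `0`: `sup_{t ∈ (0,c] ∩ J} ‖T_t‖ < ∞` for some `c ∈ J`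
(for `J ⊆ (0,∞)`, where `Set.Iic c` in `J` is `(0,c] ∩ J`). -/
def LocallyBoundedAtZero {J : Set ℝ} (T : J → E →L[𝕜] E) : Prop :=
  ∃ c : J, BddAbove ((fun t : J => ‖T t‖) '' Set.Iic c)

end UltraPower

end

noncomputable section

namespace UltraPower

/-! Lifting is linear and contractive, so (i) gives (ii), and (ii) gives (iii) by evaluation. For
(iii) ⇒ (i), constant sequences show that `T t → P` strongly. Hence `T r ∘ P = P`, and the semigroup
has a uniform bound `M`, so `T s - P = T (s - t) ∘ (T t - P)` makes errors grow by at most the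
factor `M` after time `t`. If the norm errors stayed above some `ε`, near-extremal vectors `f n` at
the times `n + 1` would form a single point of the ultrapower. Convergence there at one time `t`
makes `(T t - P) (f n)` small for `U`-many `n`, hence also `(T (n + 1) - P) (f n)` for some `n + 1 >
t`, a contradiction. -/

/-! ### Time sets -/

/-- The properties of the time sets `{1, 2, 3, …}` and `(0, ∞)` which are used for semigroups. -/
structure IsTimeSet (J : Set ℝ) : Prop where
  pos : ∀ t ∈ J, 0 < t
  add_mem : ∀ s ∈ J, ∀ t ∈ J, s + t ∈ J
  sub_mem : ∀ s ∈ J, ∀ t ∈ J, s < t → t - s ∈ J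
  natCast_succ_mem : ∀ n : ℕ, (n : ℝ) + 1 ∈ J

theorem isTimeSet_nat : IsTimeSet {t : ℝ | ∃ n : ℕ, 1 ≤ n ∧ t = n} where
  pos := by
    rintro _ ⟨n, hn, rfl⟩
    exact_mod_cast hn
  add_mem := by
    rintro _ ⟨m, hm, rfl⟩ _ ⟨n, hn, rfl⟩
    exact ⟨m + n, by omega, by push_cast; ring⟩
  sub_mem := by
    rintro _ ⟨m, hm, rfl⟩ _ ⟨n, hn, rfl⟩ h
    have h' : m < n := by exact_mod_cast h
    exact ⟨n - m, by omega, by rw [Nat.cast_sub h'.le]⟩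
  natCast_succ_mem n := ⟨n + 1, by omega, by push_cast; ring⟩

theorem isTimeSet_Ioi : IsTimeSet (Set.Ioi 0) where
  pos _ ht := ht
  add_mem _ hs _ ht := add_pos (Set.mem_Ioi.1 hs) (Set.mem_Ioi.1 ht)
  sub_mem _ _ _ _ h := sub_pos.2 h
  natCast_succ_mem n := Set.mem_Ioi.2 n.cast_add_one_pos

namespace IsTimeSet

variable {J : Set ℝ}

theorem nonempty (hJ : IsTimeSet J) : Nonempty J := ⟨⟨_, hJ.natCast_succ_mem 0⟩⟩

theorem mul_mem (hJ : IsTimeSet J) {c : ℝ} (hc : c ∈ J) (n : ℕ) : ((n : ℝ) + 1) * c ∈ J := by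
  induction n with
  | zero => simpa using hc
  | succ n ih =>
    have := hJ.add_mem _ ih _ hc
    convert this using 1
    push_cast
    ring

theorem tendsto_mul (hJ : IsTimeSet J) (c : J) :
    Tendsto (fun n : ℕ => (⟨((n : ℝ) + 1) * c, hJ.mul_mem c.2 n⟩ : J)) atTop atTop := by
  refine tendsto_atTop.2 fun b => ?_
  have h : Tendsto (fun n : ℕ => ((n : ℝ) + 1) * c) atTop atTop :=
    (tendsto_atTop_add_const_right _ 1 tendsto_natCast_atTop_atTop).atTop_mul_const
      (hJ.pos c c.2)
  exact h.eventually_ge_atTop (b : ℝ)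

theorem tendsto_add_left (hJ : IsTimeSet J) (r : J) :
    Tendsto (fun t : J => (⟨r + t, hJ.add_mem r r.2 t t.2⟩ : J)) atTop atTop := by
  refine tendsto_atTop_mono (fun t => ?_) tendsto_id
  have := hJ.pos r r.2
  change (t : ℝ) ≤ r + t
  linarith

/-- Division with remainder: each time is at most `c`, or a positive multiple of `c` plus a time
which is at most `c`. -/
theorem exists_eq_mul_add (hJ : IsTimeSet J) (c t : J) :
    t ≤ c ∨ ∃ n : ℕ, ∃ r : J, r ≤ c ∧ (t : ℝ) = ((n : ℝ) + 1) * c + r := by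
  have hc := hJ.pos c c.2
  -- Subtracting `c` while `t > c` keeps the time positive, hence in `J`; `n` bounds the number of
  -- subtractions.
  have key : ∀ n : ℕ, ∀ t : J, (t : ℝ) ≤ ((n : ℝ) + 1) * c →
      t ≤ c ∨ ∃ n : ℕ, ∃ r : J, r ≤ c ∧ (t : ℝ) = ((n : ℝ) + 1) * c + r := by
    intro n
    induction n with
    | zero => exact fun t ht => Or.inl (show (t : ℝ) ≤ c by simpa using ht)
    | succ n ih =>
      intro t ht
      rcases le_or_gt (t : ℝ) c with h | h
      · exact Or.inl h
      · refine Or.inr ?_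
        push_cast at ht
        rcases ih ⟨t - c, hJ.sub_mem c c.2 t t.2 h⟩ (by simp only; linarith) with
          h' | ⟨m, r, hr, h'⟩
        · exact ⟨0, _, h', by simp⟩
        · refine ⟨m + 1, r, hr, ?_⟩
          simp only at h'
          push_cast
          linarith
  obtain ⟨n, hn⟩ := exists_nat_ge ((t : ℝ) / c)
  refine key n t ?_
  rw [div_le_iff₀ hc] at hn
  linarith

end IsTimeSet

variable {𝕜 : Type*} [RCLike 𝕜] {E : Type*} [NormedAddCommGroup E] [NormedSpace 𝕜 E]

/-! ### Norm estimates in the ultrapower -/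

theorem lift_sub_lift_mk (U : Ultrafilter ℕ) (S T : E →L[𝕜] E) (f : EllInfty E) :
    lift U S (mk 𝕜 U f) - lift U T (mk 𝕜 U f) = mk 𝕜 U (seqMap (S - T) f) := rfl

theorem norm_lift_sub_lift_le (U : Ultrafilter ℕ) (S T : E →L[𝕜] E) :
    ‖lift U S - lift U T‖ ≤ ‖S - T‖ := by
  refine ContinuousLinearMap.opNorm_le_bound _ (norm_nonneg _) fun x => ?_
  obtain ⟨f, rfl⟩ := mk_surjective U x
  exact norm_liftLin_le U (S - T) (mk 𝕜 U f)

theorem continuous_lift (U : Ultrafilter ℕ) :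
    Continuous (lift U : (E →L[𝕜] E) → Space 𝕜 E U →L[𝕜] Space 𝕜 E U) := by
  refine (LipschitzWith.of_dist_le_mul (K := 1) fun S T => ?_).continuous
  simpa [dist_eq_norm] using norm_lift_sub_lift_le U S T

/-- Some representative has sup norm below `δ`, with room to spare, and it differs from `f` by a
sequence tending to `0` along `U`. -/
theorem eventually_norm_lt_of_norm_mk_lt {U : Ultrafilter ℕ} {f : EllInfty E} {δ : ℝ}
    (h : ‖mk 𝕜 U f‖ < δ) : ∀ᶠ n in (U : Filter ℕ), ‖f n‖ < δ := by
  obtain ⟨g, hg, hgn⟩ := Submodule.Quotient.norm_mk_lt (S := cZero 𝕜 E U) (mk 𝕜 U f)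
    (half_pos (sub_pos.2 h))
  have hfg : Tendsto (fun n => (f - g) n) (U : Filter ℕ) (𝓝 0) :=
    (Submodule.Quotient.eq (cZero 𝕜 E U)).1 hg.symm
  filter_upwards [Metric.tendsto_nhds.1 hfg _ (half_pos (sub_pos.2 h))] with n hn
  rw [dist_zero_right, lp.coeFn_sub, Pi.sub_apply] at hn
  have h1 : ‖g n‖ ≤ ‖g‖ := lp.norm_apply_le_norm (by simp) g n
  have h2 : ‖f n‖ ≤ ‖f n - g n‖ + ‖g n‖ := by
    simpa using norm_add_le (f n - g n) (g n)
  change ‖g‖ < ‖mk 𝕜 U f‖ + (δ - ‖mk 𝕜 U f‖) / 2 at hgn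
  linarith

/-- A bounded sequence as an element of `ℓ^∞(ℕ; E)`. -/
def ofBounded (f : ℕ → E) (C : ℝ) (hf : ∀ n, ‖f n‖ ≤ C) : EllInfty E :=
  ⟨f, memℓp_infty ⟨C, by rintro _ ⟨n, rfl⟩; exact hf n⟩⟩

theorem ofBounded_apply (f : ℕ → E) (C : ℝ) (hf : ∀ n, ‖f n‖ ≤ C) (n : ℕ) :
    ofBounded f C hf n = f n := rfl

/-! ### Semigroups with a strong limit -/

variable {J : Set ℝ} {T : J → E →L[𝕜] E} {P : E →L[𝕜] E}

theorem tendsto_apply_of_tendsto_lift {U : Ultrafilter ℕ}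
    (h : ∀ x : Space 𝕜 E U, Tendsto (fun t => lift U (T t) x) atTop (𝓝 (lift U P x))) (x : E) :
    Tendsto (fun t => T t x) atTop (𝓝 (P x)) := by
  rw [Metric.tendsto_nhds]
  intro ε hε
  filter_upwards [Metric.tendsto_nhds.1 (h (mk 𝕜 U (ofBounded (fun _ => x) ‖x‖ fun _ => le_rfl)))
    ε hε] with t ht
  rw [dist_eq_norm, lift_sub_lift_mk] at ht
  obtain ⟨n, hn⟩ := (eventually_norm_lt_of_norm_mk_lt ht).exists
  rwa [dist_eq_norm]

/-- Both sides at `x` are limits of `T (r + t) x = T r (T t x)`. -/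
theorem IsSemigroup.comp_limit_eq (hJ : IsTimeSet J) (hT : IsSemigroup T)
    (hP : ∀ x, Tendsto (fun t => T t x) atTop (𝓝 (P x))) (r : J) : (T r).comp P = P := by
  have := hJ.nonempty
  ext x
  refine tendsto_nhds_unique (((T r).continuous.tendsto _).comp (hP x))
    (((hP x).comp (hJ.tendsto_add_left r)).congr fun t => ?_)
  exact congrArg (fun S : E →L[𝕜] E => S x) (hT ⟨r + t, hJ.add_mem r r.2 t t.2⟩ r t rfl)

/-- A convergent net need not be bounded, so Banach–Steinhaus is applied along the multiples of `c`
only; local boundedness controls the remainders. -/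
theorem IsSemigroup.exists_norm_le [CompleteSpace E] (hJ : IsTimeSet J) (hT : IsSemigroup T)
    (hT0 : LocallyBoundedAtZero T)
    (hP : ∀ x, Tendsto (fun t => T t x) atTop (𝓝 (P x))) : ∃ M, 0 < M ∧ ∀ t, ‖T t‖ ≤ M := by
  obtain ⟨c, K, hK⟩ := hT0
  have hK' : ∀ t ≤ c, ‖T t‖ ≤ K := fun t ht => hK ⟨t, ht, rfl⟩
  have hK0 : 0 ≤ K := (norm_nonneg _).trans (hK' c le_rfl)
  obtain ⟨C, hC⟩ := banach_steinhaus
    (g := fun n : ℕ => T ⟨((n : ℝ) + 1) * c, hJ.mul_mem c.2 n⟩) fun x => by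
      obtain ⟨C, hC⟩ := ((hP x).comp (hJ.tendsto_mul c)).norm.bddAbove_range
      exact ⟨C, fun n => hC ⟨n, rfl⟩⟩
  have hC0 : 0 ≤ C := (norm_nonneg _).trans (hC 0)
  -- The `+ 1` makes the bound positive, so that it can be divided by.
  refine ⟨K + C * K + 1, by positivity, fun t => ?_⟩
  have hCK : 0 ≤ C * K := by positivity
  rcases hJ.exists_eq_mul_add c t with h | ⟨n, r, hr, h⟩
  · linarith [hK' t h]
  · rw [hT t ⟨((n : ℝ) + 1) * c, hJ.mul_mem c.2 n⟩ r h]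
    have := (ContinuousLinearMap.opNorm_comp_le _ (T r)).trans
      (mul_le_mul (hC n) (hK' r hr) (norm_nonneg _) hC0)
    linarith

theorem IsSemigroup.norm_sub_limit_apply_le (hJ : IsTimeSet J) (hT : IsSemigroup T)
    (hP : ∀ x, Tendsto (fun t => T t x) atTop (𝓝 (P x))) {M : ℝ} (hM : ∀ t, ‖T t‖ ≤ M)
    {s t : J} (hst : (t : ℝ) < s) (x : E) : ‖(T s - P) x‖ ≤ M * ‖(T t - P) x‖ := by
  have hr := hT s ⟨s - t, hJ.sub_mem t t.2 s s.2 hst⟩ t (by simp)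
  have hrP := hT.comp_limit_eq hJ hP ⟨s - t, hJ.sub_mem t t.2 s s.2 hst⟩
  set R := T ⟨s - t, hJ.sub_mem t t.2 s s.2 hst⟩ with hR
  have : T s - P = R.comp (T t - P) := by rw [ContinuousLinearMap.comp_sub, ← hr, hrP]
  rw [this]
  exact R.le_of_opNorm_le (hM _) _

theorem IsSemigroup.tendsto_of_tendsto_lift [CompleteSpace E] (hJ : IsTimeSet J)
    (hT : IsSemigroup T) (hT0 : LocallyBoundedAtZero T) {U : Ultrafilter ℕ}
    (hU : (U : Filter ℕ) ≤ cofinite)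
    (h : ∀ x : Space 𝕜 E U, Tendsto (fun t => lift U (T t) x) atTop (𝓝 (lift U P x))) :
    Tendsto T atTop (𝓝 P) := by
  have := hJ.nonempty
  have hP := tendsto_apply_of_tendsto_lift h
  obtain ⟨M, hM0, hM⟩ := hT.exists_norm_le hJ hT0 hP
  have small : ∀ ε > 0, ∃ t, ‖T t - P‖ < ε := by
    intro ε hε
    by_contra! hlarge
    have hf : ∀ n : ℕ, ∃ x : E, ‖x‖ ≤ 1 ∧
        ε / 2 < ‖(T ⟨(n : ℝ) + 1, hJ.natCast_succ_mem n⟩ - P) x‖ := by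
      intro n
      obtain ⟨x, hx, hx'⟩ := ContinuousLinearMap.exists_lt_apply_of_lt_opNorm _
        ((half_lt_self hε).trans_le (hlarge ⟨(n : ℝ) + 1, hJ.natCast_succ_mem n⟩))
      exact ⟨x, hx.le, hx'⟩
    choose f hf1 hf2 using hf
    obtain ⟨t, ht⟩ := (Metric.tendsto_nhds.1 (h (mk 𝕜 U (ofBounded f 1 hf1))) (ε / 2 / M)
      (by positivity)).exists
    rw [dist_eq_norm, lift_sub_lift_mk] at ht
    -- Freeness of `U` enters here.
    have hlt : ∀ᶠ n : ℕ in (U : Filter ℕ), (t : ℝ) < (n : ℝ) + 1 := by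
      refine (Nat.cofinite_eq_atTop ▸ hU) ?_
      filter_upwards [tendsto_natCast_atTop_atTop.eventually_ge_atTop (t : ℝ)] with n hn
      linarith
    obtain ⟨n, hn, hn'⟩ := ((eventually_norm_lt_of_norm_mk_lt ht).and hlt).exists
    rw [seqMap_apply, ofBounded_apply, lt_div_iff₀ hM0] at hn
    have := hT.norm_sub_limit_apply_le hJ hP hM
      (s := ⟨(n : ℝ) + 1, hJ.natCast_succ_mem n⟩) hn' (f n)
    linarith [hf2 n]
  rw [Metric.tendsto_nhds]
  intro ε hε
  obtain ⟨t, ht⟩ := small (ε / M) (by positivity)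
  -- The error estimate needs `s > t` strictly, since `0 ∉ J`; `t + t` is a time in `J` beyond `t`.
  filter_upwards [eventually_ge_atTop (⟨t + t, hJ.add_mem t t.2 t t.2⟩ : J)] with s hs
  have hts : (t : ℝ) < s := by
    have h1 : (t : ℝ) + t ≤ s := hs
    linarith [hJ.pos t t.2]
  rw [dist_eq_norm]
  rw [lt_div_iff₀ hM0] at ht
  refine (ContinuousLinearMap.opNorm_le_bound _ (by positivity) fun x => ?_).trans_lt
    ((mul_comm _ _).trans_lt ht)
  rw [mul_assoc]
  exact (hT.norm_sub_limit_apply_le hJ hP hM hts x).trans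
    (mul_le_mul_of_nonneg_left ((T t - P).le_opNorm x) hM0.le)

end UltraPower

end

theorem theorem2p5 {𝕜 : Type*} [RCLike 𝕜]
    {E : Type*} [NormedAddCommGroup E] [NormedSpace 𝕜 E] [CompleteSpace E]
    (J : Set ℝ) (hJ : J = {t : ℝ | ∃ n : ℕ, 1 ≤ n ∧ t = n} ∨ J = Set.Ioi 0)
    (T : J → E →L[𝕜] E) (hT : UltraPower.IsSemigroup T)
    (hT0 : UltraPower.LocallyBoundedAtZero T)
    (U : Ultrafilter ℕ) (hU : (U : Filter ℕ) ≤ Filter.cofinite)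
    (P : E →L[𝕜] E) :
    List.TFAE [
      -- operator norm convergence on the space itself
      Filter.Tendsto T Filter.atTop (nhds P),
      -- operator norm convergence of the lifted semigroup
      Filter.Tendsto (fun t : J => UltraPower.lift U (T t)) Filter.atTop
        (nhds (UltraPower.lift U P)),
      -- strong convergence of the lifted semigroup
      ∀ x : UltraPower.Space 𝕜 E U,
        Filter.Tendsto (fun t : J => UltraPower.lift U (T t) x) Filter.atTop
          (nhds (UltraPower.lift U P x))] := by
  have hJ' : UltraPower.IsTimeSet J := by
    rcases hJ with rfl | rfl
    · exact UltraPower.isTimeSet_nat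
    · exact UltraPower.isTimeSet_Ioi
  tfae_have 1 → 2 := fun h => ((UltraPower.continuous_lift U).tendsto P).comp h
  tfae_have 2 → 3 := fun h x =>
    ((ContinuousLinearMap.apply 𝕜 _ x).continuous.tendsto (UltraPower.lift U P)).comp h
  tfae_have 3 → 1 := hT.tendsto_of_tendsto_lift hJ' hT0 hU
  tfae_finish
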